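/- **Deep Maximum Theorem: Convex Case.** Let $\sigma:\mathbb{R}\to\mathbb{R}$ be continuous, and differentiable at some point $x_0$ with $\sigma'(x_0)\neq 0$. Let $K\subseteq\mathbb{R}^m$ be non-empty and compact. Let $(C_x)_{x\in\mathbb{R}^n}$ be non-empty closed subsets of $\mathbb{R}^m$ with $C_x\cap K\neq\emptyset$ for every $x$, which are weakly measurable: $\{x: C_x\cap U\neq\emptyset\}$ is Borel for every relatively open $U\subseteq K$. Let $L:\mathbb{R}^n\times\mathbb{R}^m\to\mathbb{R}$ be continuous in $y$ and Borel measurable in $x$ (for instance, jointly continuous), and let $\mathbb{P}$ be a Borel probability measure on $\mathbb{R}^n$. Suppose that each $C_x\cap K$ is convex and that each $L(x,\cdot)$ is strictly convex on $\mathbb{R}^m$. Notation. A feedforward network $\hat f:\mathbb{R}^n\to\mathbb{R}^N$ is a composition of finitely many layers $z\mapsto\sigma(Az+b)$ ($\sigma$ applied coordinatewise) followed by a linear map $z\mapsto Az$; its width is the largest dimension of its layers, input and output included. $\operatorname{Softmax}_N(w)_k=e^{w_k}/\sum_j e^{w_j}$; for an $N\times m$ matrix $Y$ with rows $Y_k$,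 $\operatorname{Attention}(w,Y)=\sum_k\operatorname{Softmax}_N(w)_kY_k$; for an $N\times Q\times m$ array $y=(y_{k,q})$ of points of $\mathbb{R}^m$, $\operatorname{P-attention}(w,y)=\frac1Q\sum_{k,q}\operatorname{Softmax}_N(w)_k\,\delta_{y_{k,q}}$. $\mathcal{W}_1$ is the Wasserstein-1 distance, and $\mathcal{W}_1(\mu,B)=\inf_{b\in B}\mathcal{W}_1(\mu,\delta_b)$ for a set $B$. For $0<\epsilon\le1$, say that a network $\hat f:\mathbb{R}^n\to\mathbb{R}^N$ of width at most $2+n+N$, an array $y$ as above, and a compact set $\mathcal{X}_\epsilon\subseteq\mathbb{R}^n$ are *$\epsilon$-optimal* if the measures $\hat F(x)=\operatorname{P-attention}(\hat f(x),y)$ satisfy $\bigcup_{x\in\mathbb{R}^n}\operatorname{supp}\hat F(x)\subseteq K$, $\mathcal{W}_1\big(\hat F(x),\operatorname{argmin}_{z\in C_x\cap K}L(x,z)\big)\le\epsilon$ for all $x\in\mathcal{X}_\epsilon$, and $1-\mathbb{P}(\mathcal{X}_\epsilon)\le\epsilon$. Then for every $x\in\mathbb{R}^n$ the function $L(x,\cdot)$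 has a unique minimizer $y^\star(x)$ on $C_x\cap K$, and for every $0<\epsilon\le1$: (1) there are $N\ge1$, a network $\hat f$, an $N\times m$ matrix of particles (that is, an array with $Q=1$) and a compact set $\mathcal{X}_\epsilon$ which are $\epsilon$-optimal; (2) for all $N,Q\ge1$, all $\epsilon$-optimal $(\hat f,y,\mathcal{X}_\epsilon)$ and every $\mathbb{R}^m$-valued random field $(Y^x)_{x\in\mathbb{R}^n}$ with $Y^x\sim\hat F(x)$, each $Y^x$ is integrable and $$\mathbb{E}[Y^x]=\operatorname{Attention}(\hat f(x),Y)\quad\text{for all }x\in\mathbb{R}^n,\qquad\text{where } Y=\Big(\tfrac1Q\sum_{q=1}^Q y_{k,q}\Big)_{k=1}^N;$$ moreover (i) if $K$ is convex, then $\mathbb{E}[Y^x]\in K$ for all $x\in\mathbb{R}^n$; and (ii) $\|\mathbb{E}[Y^x]-y^\star(x)\|\le\epsilon$ for all $x\in\mathcal{X}_\epsilon$. -/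

import Mathlib

open MeasureTheory ProbabilityTheory
open scoped ENNReal

noncomputable section

/-- The Euclidean space `ℝᵈ`. -/
abbrev Euc (d : ℕ) : Type := EuclideanSpace ℝ (Fin d)

/-- The assumption on the activation function: `σ` is continuous, and it is differentiable at some
point with non-zero derivative there. -/
def AdmissibleActivation (σ : ℝ → ℝ) : Prop :=
  Continuous σ ∧ ∃ x₀ : ℝ, DifferentiableAt ℝ σ x₀ ∧ deriv σ x₀ ≠ 0

/-- Parameters of a feedforward network with `n` inputs and `N` outputs: finitely many hidden
layers, each given by a weight matrix and a bias vector, followed by a linear readout. -/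
inductive Network : ℕ → ℕ → Type
  | readout {n N : ℕ} (A : Matrix (Fin N) (Fin n) ℝ) : Network n N
  | layer {n d N : ℕ} (A : Matrix (Fin d) (Fin n) ℝ) (b : Fin d → ℝ) (rest : Network d N) :
      Network n N

namespace Network

/-- The function computed by a network with activation function `σ`; a hidden layer is
`x ↦ σ (A x + b)`, with `σ` applied coordinatewise. -/
def eval (σ : ℝ → ℝ) : {n N : ℕ} → Network n N → (Fin n → ℝ) → (Fin N → ℝ)
  | _, _, readout A, x => A.mulVec x
  | _, _, layer A b rest, x => eval σ rest (fun i => σ (A.mulVec x i + b i))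

/-- The width: the largest dimension of a layer, input and output layer included. -/
def width : {n N : ℕ} → Network n N → ℕ
  | n, N, readout _ => max n N
  | n, _, layer _ _ rest => max n (width rest)

end Network

/-- `Softmax_N`. -/
def softmax {N : ℕ} (w : Fin N → ℝ) (k : Fin N) : ℝ :=
  Real.exp (w k) / ∑ j, Real.exp (w j)

/-- `Attention(w, Y)`, the rows of the `N × m` matrix `Y` being the points `Y k` of `ℝᵐ`. -/
def attention {N m : ℕ} (w : Fin N → ℝ) (Y : Fin N → Euc m) : Euc m :=
  ∑ k, softmax w k • Y k

/-- `P-attention(w, Y)` for an `N × Q × m` array `Y`; an `N × m` matrix is the case `Q = 1`. -/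
def pAttention {N Q m : ℕ} (w : Fin N → ℝ) (Y : Fin N → Fin Q → Euc m) : Measure (Euc m) :=
  (Q : ℝ≥0∞)⁻¹ • ∑ k, ∑ q, ENNReal.ofReal (softmax w k) • Measure.dirac (Y k q)

/-- The `N × m` matrix of averaged particles. -/
def averagedParticles {N Q m : ℕ} (Y : Fin N → Fin Q → Euc m) (k : Fin N) : Euc m :=
  (Q : ℝ)⁻¹ • ∑ q, Y k q

/-- The Wasserstein-1 distance: the infimum of the transport cost over all couplings. -/
def W1 {m : ℕ} (μ ν : Measure (Euc m)) : ℝ≥0∞ :=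
  ⨅ (π : Measure (Euc m × Euc m)) (_ : π.map Prod.fst = μ ∧ π.map Prod.snd = ν),
    ∫⁻ p, edist p.1 p.2 ∂π

/-- The Wasserstein-1 distance of a measure to (the point masses at the points of) a set. -/
def W1ToSet {m : ℕ} (μ : Measure (Euc m)) (B : Set (Euc m)) : ℝ≥0∞ :=
  ⨅ b ∈ B, W1 μ (Measure.dirac b)

/-- `C` is a weakly measurable correspondence, relative to `K`: its values are non-empty and, for
every relatively open subset `U ∩ K` of `K`, the set of all `x` such that `C x` meets `U ∩ K` is
Borel. -/
def WeaklyMeasurableCorrespondence {n m : ℕ} (K : Set (Euc m)) (C : Euc n → Set (Euc m)) : Prop :=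
  (∀ x, (C x).Nonempty) ∧
    ∀ U : Set (Euc m), IsOpen U → MeasurableSet {x | (C x ∩ (U ∩ K)).Nonempty}

/-- The set of minimizers of `f` on `S`. -/
def argminOn {m : ℕ} (f : Euc m → ℝ) (S : Set (Euc m)) : Set (Euc m) :=
  {y | y ∈ S ∧ ∀ z ∈ S, f y ≤ f z}

/-- The model `F̂(x) = P-attention(f̂(x), Y)`, for a network `f̂` and an array `Y`. -/
def model {n N Q m : ℕ} (σ : ℝ → ℝ) (f : Network n N) (Y : Fin N → Fin Q → Euc m) (x : Euc n) :
    Measure (Euc m) :=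
  pAttention (f.eval σ x.ofLp) Y

/-- The network `f`, the particles `Y` and the set `X` solve the constrained optimization problem up
to `ε`: the model is supported in `K`, and on the compact set `X`, whose complement has probability
at most `ε`, it is `ε`-close to the set of minimizers of `L x` on `C x ∩ K`. -/
structure ProbablyApproximatelyOptimal {n m N Q : ℕ} (σ : ℝ → ℝ) (K : Set (Euc m))
    (C : Euc n → Set (Euc m)) (L : Euc n → Euc m → ℝ) (P : Measure (Euc n)) (ε : ℝ)
    (f : Network n N) (Y : Fin N → Fin Q → Euc m) (X : Set (Euc n)) : Prop where
  width_le : f.width ≤ 2 + n + N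
  support_subset : (⋃ x, (model σ f Y x).support) ⊆ K
  isCompact : IsCompact X
  optimal : ∀ x ∈ X, W1ToSet (model σ f Y x) (argminOn (L x) (C x ∩ K)) ≤ ENNReal.ofReal ε
  prob : 1 - P.real X ≤ ε

end

/-! Existence: the minimizer `ystar` is unique by strict convexity and Borel by the measurable
maximum theorem (`measurable_of_argminOn_eq_singleton`). By `exists_isCompact_dist_le` it oscillates
little at small scales on a compact `X` of large probability. Choose a finite net `c k` in `X` and
the particles `ystar (c k)`. The scores `-lam * dist x (c k) ^ 2` differ from affine functions of
`x` only by a term independent of `k`, which softmax ignores, so a network with one hidden layer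
suffices. For large `lam` the weight sits on centres near `x`, whose particles are close to `ystar
x`.

Means: the only coupling with a point mass is the product, so `W1` to `ystar x` is an expected
distance and bounds the error of the mean. The mean is a convex combination of particles, all of
which lie in `K` because softmax weights are positive. -/

lemma softmax_pos {N : ℕ} (w : Fin N → ℝ) (k : Fin N) : 0 < softmax w k :=
  div_pos (Real.exp_pos _) (Finset.sum_pos (fun _ _ => Real.exp_pos _) ⟨k, Finset.mem_univ k⟩)

lemma sum_softmax {N : ℕ} (hN : 0 < N) (w : Fin N → ℝ) : ∑ k, softmax w k = 1 := by
  have : 0 < ∑ j, Real.exp (w j) :=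
    Finset.sum_pos (fun _ _ => Real.exp_pos _) ⟨⟨0, hN⟩, Finset.mem_univ _⟩
  simp only [softmax, ← Finset.sum_div]
  exact div_self this.ne'

lemma softmax_le_exp_sub {N : ℕ} (w : Fin N → ℝ) (j k : Fin N) :
    softmax w k ≤ Real.exp (w k - w j) := by
  rw [softmax, Real.exp_sub]
  gcongr
  exact Finset.single_le_sum (f := fun i => Real.exp (w i)) (fun i _ => (Real.exp_pos _).le)
    (Finset.mem_univ j)

/-! ### Attention measures: integrals, support, mean. -/

section PAttention

variable {N Q m : ℕ} (w : Fin N → ℝ) (Y : Fin N → Fin Q → Euc m)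

lemma lintegral_pAttention (g : Euc m → ℝ≥0∞) :
    ∫⁻ z, g z ∂(pAttention w Y) =
      (Q : ℝ≥0∞)⁻¹ * ∑ k, ∑ q, ENNReal.ofReal (softmax w k) * g (Y k q) := by
  simp [pAttention, lintegral_smul_measure, lintegral_finsetSum_measure]

lemma integrable_pAttention (hQ : 0 < Q) {E : Type*} [NormedAddCommGroup E] (g : Euc m → E) :
    Integrable g (pAttention w Y) := by
  refine Integrable.smul_measure ?_ (by simp [hQ.ne'])
  refine integrable_finsetSum_measure.2 fun k _ => integrable_finsetSum_measure.2 fun q _ => ?_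
  exact (integrable_dirac (by simp)).smul_measure ENNReal.ofReal_ne_top

lemma integral_pAttention {E : Type*} [NormedAddCommGroup E] [NormedSpace ℝ E]
    [CompleteSpace E] (g : Euc m → E) :
    ∫ z, g z ∂(pAttention w Y) = (Q : ℝ)⁻¹ • ∑ k, ∑ q, softmax w k • g (Y k q) := by
  have h : ∀ k q, Integrable g (ENNReal.ofReal (softmax w k) • Measure.dirac (Y k q)) :=
    fun k q => (integrable_dirac (by simp)).smul_measure ENNReal.ofReal_ne_top
  rw [pAttention, integral_smul_measure, integral_finsetSum_measure
    (fun k _ => integrable_finsetSum_measure.2 fun q _ => h k q)]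
  simp_rw [integral_finsetSum_measure (fun q _ => h _ q), integral_smul_measure, integral_dirac,
    ENNReal.toReal_ofReal (softmax_pos w _).le]
  simp

lemma isProbabilityMeasure_pAttention (hN : 0 < N) (hQ : 0 < Q) :
    IsProbabilityMeasure (pAttention w Y) := by
  constructor
  rw [← lintegral_one, lintegral_pAttention]
  simp only [mul_one, Finset.sum_const, Finset.card_univ, Fintype.card_fin, nsmul_eq_mul]
  rw [← Finset.mul_sum, ← ENNReal.ofReal_sum_of_nonneg (fun k _ => (softmax_pos w k).le),
    sum_softmax hN, ENNReal.ofReal_one, mul_one]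
  exact ENNReal.inv_mul_cancel (by simp [hQ.ne']) (by simp)

/-- Softmax never vanishes, so every particle is an atom; a bound on the support thus constrains all
particles. -/
lemma mem_support_pAttention (k : Fin N) (q : Fin Q) :
    Y k q ∈ (pAttention w Y).support := by
  refine (Measure.mem_support_iff_forall _).2 fun U hU => ?_
  refine pos_iff_ne_zero.2 fun h0 => ?_
  simp only [pAttention, Measure.smul_apply, Measure.coe_finsetSum, Finset.sum_apply,
    smul_eq_mul, mul_eq_zero, ENNReal.inv_eq_zero, ENNReal.natCast_ne_top, false_or,
    Finset.sum_eq_zero_iff] at h0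
  have := h0 k (Finset.mem_univ k) q (Finset.mem_univ q)
  simp only [Measure.dirac_apply_of_mem (mem_of_mem_nhds hU), one_ne_zero, or_false,
    ENNReal.ofReal_eq_zero] at this
  exact this.not_gt (softmax_pos w k)

lemma support_pAttention_subset {K : Set (Euc m)} (hK : IsClosed K) (hY : ∀ k q, Y k q ∈ K) :
    (pAttention w Y).support ⊆ K := by
  refine Measure.support_subset_of_isClosed hK ?_
  rw [mem_ae_iff]
  simp [pAttention, Measure.dirac_apply' _ hK.measurableSet.compl, hY]

lemma attention_averagedParticles :
    attention w (averagedParticles Y) = (Q : ℝ)⁻¹ • ∑ k, ∑ q, softmax w k • Y k q := by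
  simp only [attention, averagedParticles, Finset.smul_sum]
  exact Finset.sum_congr rfl fun k _ => Finset.sum_congr rfl fun q _ => smul_comm _ _ _

lemma attention_averagedParticles_mem (hN : 0 < N) (hQ : 0 < Q) {K : Set (Euc m)}
    (hK : Convex ℝ K) (hY : ∀ k q, Y k q ∈ K) : attention w (averagedParticles Y) ∈ K := by
  refine hK.sum_mem (fun k _ => (softmax_pos w k).le) (sum_softmax hN w) fun k _ => ?_
  rw [averagedParticles, Finset.smul_sum]
  refine hK.sum_mem (fun _ _ => by positivity) ?_ fun q _ => hY k q
  simp [hQ.ne']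

end PAttention

/-! ### Wasserstein distance to a point mass, and unique minimizers. -/

/-- A coupling with second marginal `dirac b` lives on `p.2 = b`, so its cost depends on the first
marginal alone. -/
lemma W1_dirac {m : ℕ} (μ : Measure (Euc m)) [IsProbabilityMeasure μ] (b : Euc m) :
    W1 μ (Measure.dirac b) = ∫⁻ z, edist z b ∂μ := by
  apply le_antisymm
  · have hm : Measurable fun z : Euc m => (z, b) := by fun_prop
    have hmarg : (μ.map fun z => (z, b)).map Prod.fst = μ ∧
        (μ.map fun z => (z, b)).map Prod.snd = Measure.dirac b := by
      constructor
      · rw [Measure.map_map measurable_fst hm]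
        exact Measure.map_id
      · rw [Measure.map_map measurable_snd hm]
        change μ.map (fun _ => b) = _
        simp
    refine (iInf₂_le (μ.map fun z => (z, b)) hmarg).trans ?_
    rw [lintegral_map (by fun_prop) hm]
  · refine le_iInf₂ fun π hπ => ?_
    have hb : ∀ᵐ p ∂π, p.2 = b := by
      have : ∀ᵐ z ∂(π.map Prod.snd), z = b := by
        rw [hπ.2]
        exact (ae_dirac_iff (measurableSet_singleton b)).2 rfl
      exact ae_of_ae_map measurable_snd.aemeasurable this
    rw [← hπ.1, lintegral_map (by fun_prop) measurable_fst]
    refine (lintegral_congr_ae ?_).le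
    filter_upwards [hb] with p hp
    rw [hp]

lemma W1ToSet_singleton {m : ℕ} (μ : Measure (Euc m)) [IsProbabilityMeasure μ] (b : Euc m) :
    W1ToSet μ {b} = ∫⁻ z, edist z b ∂μ := by
  simp [W1ToSet, W1_dirac]

lemma norm_integral_sub_le_of_lintegral_edist_le {m : ℕ} {Ω : Type*} [MeasurableSpace Ω]
    {P : Measure Ω} [IsProbabilityMeasure P] {Z : Ω → Euc m} (hZ : Integrable Z P) (b : Euc m)
    {ε : ℝ} (hε : 0 ≤ ε) (h : ∫⁻ ω, edist (Z ω) b ∂P ≤ ENNReal.ofReal ε) :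
    ‖(∫ ω, Z ω ∂P) - b‖ ≤ ε := by
  have h1 : (∫ ω, Z ω ∂P) - b = ∫ ω, (Z ω - b) ∂P := by
    rw [integral_sub hZ (integrable_const b)]
    simp
  have h2 : ENNReal.ofReal ‖∫ ω, (Z ω - b) ∂P‖ ≤ ENNReal.ofReal ε := by
    rw [ofReal_norm]
    refine (enorm_integral_le_lintegral_enorm _).trans ?_
    simpa only [edist_eq_enorm_sub] using h
  rw [h1]
  exact (ENNReal.ofReal_le_ofReal_iff hε).1 h2

lemma exists_argminOn_eq_singleton {m : ℕ} {f : Euc m → ℝ} (hf : Continuous f)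
    (hc : StrictConvexOn ℝ Set.univ f) {S : Set (Euc m)} (hS : IsCompact S) (hne : S.Nonempty)
    (hconv : Convex ℝ S) : ∃ y, argminOn f S = {y} := by
  obtain ⟨y, hyS, hy⟩ := hS.exists_isMinOn hne hf.continuousOn
  refine ⟨y, Set.eq_singleton_iff_unique_mem.2 ⟨⟨hyS, fun z hz => hy hz⟩, fun z hz => ?_⟩⟩
  exact (hc.subset (Set.subset_univ _) hconv).eq_of_isMinOn (fun u hu => hz.2 u hu) hy hz.1 hyS

/-! ### Networks approximating affine maps. -/

lemma exists_rescaling_approx {σ : ℝ → ℝ} {x₀ : ℝ} (hd : DifferentiableAt ℝ σ x₀)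
    (hne : deriv σ x₀ ≠ 0) (R : ℝ) {κ : ℝ} (hκ : 0 < κ) :
    ∃ δ : ℝ, 0 < δ ∧ ∀ t, |t| ≤ R →
      |(σ (δ * t + x₀) - σ x₀) / (δ * deriv σ x₀) - t| ≤ κ := by
  set D := deriv σ x₀
  set R' := |R| + 1
  have hR' : 0 < R' := by positivity
  have hD : 0 < |D| := abs_pos.2 hne
  have hc : 0 < κ * |D| / R' := by positivity
  have h := hd.hasDerivAt.isLittleO.def hc
  obtain ⟨ρ, hρ, hball⟩ := Metric.eventually_nhds_iff.1 h
  refine ⟨ρ / (2 * R'), by positivity, fun t ht => ?_⟩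
  set δ := ρ / (2 * R')
  have hδ : 0 < δ := by positivity
  have htR : |t| ≤ R' := ht.trans ((le_abs_self R).trans (by simp [R']))
  have hδt : |δ * t| < ρ := by
    rw [abs_mul, abs_of_pos hδ]
    calc δ * |t| ≤ δ * R' := by gcongr
      _ = ρ / 2 := by simp only [δ]; field_simp
      _ < ρ := by linarith
  have h1 := hball (y := δ * t + x₀) (by simpa [Real.dist_eq] using hδt)
  simp only [add_sub_cancel_right, smul_eq_mul, Real.norm_eq_abs] at h1
  have h2 : (σ (δ * t + x₀) - σ x₀) / (δ * D) - t
      = (σ (δ * t + x₀) - σ x₀ - δ * t * D) / (δ * D) := by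
    field_simp
  rw [h2, abs_div, div_le_iff₀ (by positivity)]
  refine h1.trans ?_
  rw [abs_mul, abs_mul, abs_of_pos hδ]
  calc κ * |D| / R' * (δ * |t|) ≤ κ * |D| / R' * (δ * R') := by gcongr
    _ = κ * (δ * |D|) := by field_simp

lemma AdmissibleActivation.exists_ne_zero {σ : ℝ → ℝ} (hσ : AdmissibleActivation σ) :
    ∃ c, σ c ≠ 0 := by
  by_contra! h
  obtain ⟨-, x₀, -, hne⟩ := hσ
  apply hne
  rw [show σ = fun _ => 0 from funext h, deriv_const]

/-- Networks of width `max n (n + 1) N` approximate affine maps uniformly on bounded sets. -/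
lemma exists_network_approx_affine {σ : ℝ → ℝ} (hσ : AdmissibleActivation σ) {n N : ℕ}
    (A : Fin N → Fin n → ℝ) (b : Fin N → ℝ) (R : ℝ) {η : ℝ} (hη : 0 < η) :
    ∃ f : Network n N, f.width ≤ 2 + n + N ∧ ∀ z : Fin n → ℝ, (∀ i, |z i| ≤ R) →
      ∀ k, |f.eval σ z k - (∑ i, A k i * z i + b k)| ≤ η := by
  obtain ⟨c, hc⟩ := hσ.exists_ne_zero
  obtain ⟨-, x₀, hd, hne⟩ := hσ
  set S := ∑ k, ∑ i, |A k i|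
  have hS : 0 ≤ S := by positivity
  obtain ⟨δ, hδ, happrox⟩ := exists_rescaling_approx hd hne R (κ := η / (S + 1)) (by positivity)
  set D := deriv σ x₀
  -- Neuron `0` ignores the input and outputs `σ c ≠ 0`, standing in for the bias that the readout
  -- does not have. Neuron `i + 1` outputs `σ (δ * z i + x₀)`, which the readout rescales to nearly
  -- `z i`.
  let W : Matrix (Fin (n + 1)) (Fin n) ℝ := Matrix.of
    (Fin.cons 0 fun i => Pi.single i δ)
  let β : Fin (n + 1) → ℝ := Fin.cons c fun _ => x₀
  let V : Matrix (Fin N) (Fin (n + 1)) ℝ := Matrix.of fun k =>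
    Fin.cons ((b k - ∑ i, A k i * (σ x₀ / (δ * D))) / σ c) fun i => A k i / (δ * D)
  refine ⟨.layer W β (.readout V), ?_, fun z hz k => ?_⟩
  · simp only [Network.width]
    omega
  have heval : (Network.layer W β (.readout V)).eval σ z k - (∑ i, A k i * z i + b k)
      = ∑ i, A k i * ((σ (δ * z i + x₀) - σ x₀) / (δ * D) - z i) := by
    simp only [Network.eval, Matrix.mulVec, dotProduct, Fin.sum_univ_succ, V, W, β,
      Matrix.of_apply, Fin.cons_zero, Fin.cons_succ, Pi.zero_apply, zero_mul,
      Finset.sum_const_zero, zero_add, div_mul_cancel₀ _ hc]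
    simp only [Pi.single_apply, ite_mul, zero_mul, Finset.sum_ite_eq',
      Finset.mem_univ, if_true, mul_sub, sub_div, Finset.sum_sub_distrib, div_mul_eq_mul_div,
      mul_div_assoc]
    ring
  rw [heval]
  calc |∑ i, A k i * ((σ (δ * z i + x₀) - σ x₀) / (δ * D) - z i)|
      ≤ ∑ i, |A k i| * (η / (S + 1)) := by
        refine (Finset.abs_sum_le_sum_abs _ _).trans (Finset.sum_le_sum fun i _ => ?_)
        rw [abs_mul]
        exact mul_le_mul_of_nonneg_left (happrox _ (hz i)) (abs_nonneg _)
    _ = (∑ i, |A k i|) * (η / (S + 1)) := by rw [Finset.sum_mul]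
    _ ≤ (S + 1) * (η / (S + 1)) := by
        gcongr
        have := Finset.single_le_sum (f := fun k => ∑ i, |A k i|)
          (fun k _ => Finset.sum_nonneg fun i _ => abs_nonneg _) (Finset.mem_univ k)
        simp only [S]
        linarith
    _ = η := by field_simp

/-! ### Measurability of the minimizer. -/

section MeasurableSelection

variable {n m : ℕ} {K : Set (Euc m)} {C : Euc n → Set (Euc m)} {L : Euc n → Euc m → ℝ}

lemma measurableSet_forall_mem_le (hLcont : ∀ x, Continuous (L x))
    (hLmeas : ∀ y, Measurable fun x => L x y) (B : Set (Euc m)) (s : ℝ) :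
    MeasurableSet {x | ∀ y ∈ B, L x y ≤ s} := by
  obtain ⟨D, hDB, hDc, hD⟩ :=
    (TopologicalSpace.IsSeparable.of_separableSpace B).exists_countable_dense_subset
  have : {x | ∀ y ∈ B, L x y ≤ s} = ⋂ y ∈ D, {x | L x y ≤ s} := by
    ext x
    simp only [Set.mem_ofPred_eq, Set.mem_iInter]
    refine ⟨fun h y hy => h y (hDB hy), fun h y hy => ?_⟩
    exact closure_minimal (t := {y | L x y ≤ s}) h
      (isClosed_le (hLcont x) continuous_const) (hD hy)
  rw [this]
  exact MeasurableSet.biInter hDc fun y _ => measurableSet_le (hLmeas y) measurable_const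

/-- By continuity, `L x y < t` persists with a rational margin on a basic neighbourhood `B` of `y`.
Demanding the bound on all of `B ∩ K` separates the condition on `C x` from the one on `L x`. -/
lemma measurableSet_exists_mem_lt (hC : WeaklyMeasurableCorrespondence K C)
    (hLcont : ∀ x, Continuous (L x)) (hLmeas : ∀ y, Measurable fun x => L x y)
    {V : Set (Euc m)} (hV : IsOpen V) (t : ℝ) :
    MeasurableSet {x | ∃ y ∈ C x ∩ K, y ∈ V ∧ L x y < t} := by
  have hb := TopologicalSpace.isBasis_countableBasis (Euc m)
  have : {x | ∃ y ∈ C x ∩ K, y ∈ V ∧ L x y < t} =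
      ⋃ B ∈ TopologicalSpace.countableBasis (Euc m), ⋃ (_ : B ⊆ V), ⋃ s : ℚ, ⋃ (_ : (s : ℝ) < t),
        {x | (C x ∩ (B ∩ K)).Nonempty} ∩ {x | ∀ y ∈ B ∩ K, L x y ≤ s} := by
    ext x
    simp only [Set.mem_ofPred_eq, Set.mem_iUnion, Set.mem_inter_iff, exists_prop]
    constructor
    · rintro ⟨y, ⟨hyC, hyK⟩, hyV, hyt⟩
      obtain ⟨s, hys, hst⟩ := exists_rat_btwn hyt
      have ho : IsOpen (V ∩ {z | L x z < s}) :=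
        hV.inter (isOpen_lt (hLcont x) continuous_const)
      have hyo : y ∈ V ∩ {z | L x z < s} := ⟨hyV, hys⟩
      obtain ⟨B, hB, hyB, hBV⟩ := hb.exists_subset_of_mem_open hyo ho
      have hne : (C x ∩ (B ∩ K)).Nonempty := ⟨y, hyC, hyB, hyK⟩
      exact ⟨B, hB, fun z hz => (hBV hz).1, s, hst, hne,
        fun z hz => (hBV hz.1).2.le⟩
    · rintro ⟨B, -, hBV, s, hst, ⟨y, hyC, hyB, hyK⟩, hle⟩
      have hys : L x y ≤ s := hle y ⟨hyB, hyK⟩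
      exact ⟨y, ⟨hyC, hyK⟩, hBV hyB, hys.trans_lt hst⟩
  rw [this]
  refine MeasurableSet.biUnion (TopologicalSpace.countable_countableBasis _) fun B hB => ?_
  refine MeasurableSet.iUnion fun _ => MeasurableSet.iUnion fun s => MeasurableSet.iUnion fun _ => ?_
  exact (hC.2 B (hb.isOpen hB)).inter (measurableSet_forall_mem_le hLcont hLmeas _ _)

/-- The measurable maximum theorem, for a unique minimizer. -/
lemma measurable_of_argminOn_eq_singleton (hK : IsCompact K)
    (hC : WeaklyMeasurableCorrespondence K C) (hCclosed : ∀ x, IsClosed (C x))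
    (hLcont : ∀ x, Continuous (L x)) (hLmeas : ∀ y, Measurable fun x => L x y)
    {ystar : Euc n → Euc m} (hy : ∀ x, argminOn (L x) (C x ∩ K) = {ystar x}) :
    Measurable ystar := by
  have hmem : ∀ x, ystar x ∈ argminOn (L x) (C x ∩ K) := fun x => by rw [hy x]; rfl
  refine measurable_of_isClosed fun F hF => ?_
  let u : ℕ → ℝ := fun k => 1 / ((k : ℝ) + 1)
  have hu : ∀ k, 0 < u k := fun k => Nat.one_div_pos_of_nat
  have hanti : Antitone u := fun _ _ h => Nat.one_div_le_one_div h
  have hlim : Filter.Tendsto u Filter.atTop (nhds 0) := tendsto_one_div_add_atTop_nhds_zero_nat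
  -- The minimizer lies in `F` iff every level attained strictly on `C x ∩ K` is also attained
  -- arbitrarily near `F`. Thickenings replace `F` because the measurability lemma needs open sets.
  have : ystar ⁻¹' F = ⋂ t : ℚ, ⋂ k : ℕ,
      {x | ∃ y ∈ C x ∩ K, y ∈ Set.univ ∧ L x y < t}ᶜ ∪
        {x | ∃ y ∈ C x ∩ K, y ∈ Metric.thickening (u k) F ∧ L x y < t} := by
    ext x
    simp only [Set.mem_preimage, Set.mem_iInter, Set.mem_union, Set.mem_compl_iff,
      Set.mem_ofPred_eq, Set.mem_univ, true_and]
    constructor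
    · intro hx t k
      refine or_iff_not_imp_left.2 fun h => ?_
      obtain ⟨y, hyS, hyt⟩ := not_not.1 h
      exact ⟨ystar x, (hmem x).1, Metric.self_subset_thickening (hu k) F hx,
        ((hmem x).2 y hyS).trans_lt hyt⟩
    · intro h
      -- Nested compact sets of near-minimizers near `F`: a common point is a minimizer in `F`,
      -- hence `ystar x`.
      let T : ℕ → Set (Euc m) := fun k => (C x ∩ K) ∩
        (Metric.cthickening (u k) F ∩ {y | L x y ≤ L x (ystar x) + u k})
      have hScl : IsClosed (C x ∩ K) := (hCclosed x).inter hK.isClosed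
      have hTcl : ∀ k, IsClosed (T k) := fun k =>
        hScl.inter (Metric.isClosed_cthickening.inter
          (isClosed_le (hLcont x) continuous_const))
      have hne : (⋂ k, T k).Nonempty := by
        refine IsCompact.nonempty_iInter_of_sequence_nonempty_isCompact_isClosed T ?_ ?_ ?_ hTcl
        · rintro k y ⟨h1, h2, h3⟩
          have hk := hanti (Nat.le_succ k)
          rw [Set.mem_ofPred_eq] at h3
          exact ⟨h1, Metric.cthickening_mono hk F h2, h3.trans (by gcongr)⟩
        · intro k
          obtain ⟨t, ht1, ht2⟩ := exists_rat_btwn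
            (show L x (ystar x) < L x (ystar x) + u k by linarith [hu k])
          rcases h t k with h' | ⟨y, hyS, hyF, hyt⟩
          · exact absurd ⟨ystar x, (hmem x).1, ht1⟩ h'
          · exact ⟨y, hyS, Metric.thickening_subset_cthickening _ _ hyF, (hyt.trans ht2).le⟩
        · exact hK.of_isClosed_subset (hTcl 0) fun y hy => hy.1.2
      obtain ⟨y, hyT⟩ := hne
      rw [Set.mem_iInter] at hyT
      have hyle : L x y ≤ L x (ystar x) := by
        have := hlim.const_add (L x (ystar x))
        rw [add_zero] at this
        exact ge_of_tendsto' this fun k => (hyT k).2.2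
      have hyeq : y ∈ argminOn (L x) (C x ∩ K) :=
        ⟨(hyT 0).1, fun z hz => hyle.trans ((hmem x).2 z hz)⟩
      rw [hy x, Set.mem_singleton_iff] at hyeq
      rw [← hyeq]
      have hinf : Metric.infEDist y F ≤ 0 := by
        have h0 : Filter.Tendsto (fun k => ENNReal.ofReal (u k)) Filter.atTop (nhds 0) := by
          simpa using ENNReal.tendsto_ofReal hlim
        exact ge_of_tendsto' h0 fun k => Metric.mem_cthickening_iff.1 (hyT k).2.1
      rw [← hF.closure_eq, Metric.mem_closure_iff_infEDist_zero]
      exact le_antisymm hinf zero_le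
  rw [this]
  exact MeasurableSet.iInter fun t => MeasurableSet.iInter fun k =>
    (measurableSet_exists_mem_lt hC hLcont hLmeas isOpen_univ t).compl.union
      (measurableSet_exists_mem_lt hC hLcont hLmeas Metric.isOpen_thickening t)

end MeasurableSelection

/-! ### Approximation of measurable functions by attention. -/

/-- A weak form of Lusin's theorem: up to an oscillation `η`, a bounded measurable function is
uniformly continuous on a compact set of almost full measure. -/
lemma exists_isCompact_dist_le {n m : ℕ} (P : Measure (Euc n)) [IsProbabilityMeasure P]
    {g : Euc n → Euc m} (hg : Measurable g) {M : ℝ} (hM : ∀ x, ‖g x‖ ≤ M)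
    {ε η : ℝ} (hε : 0 < ε) (hε1 : ε ≤ 1) (hη : 0 < η) :
    ∃ X : Set (Euc n), IsCompact X ∧ X.Nonempty ∧ 1 - P.real X ≤ ε ∧
      ∃ δ : ℝ, 0 < δ ∧ ∀ x ∈ X, ∀ x' ∈ X, dist x x' < δ → dist (g x) (g x') ≤ η := by
  have hint : Integrable g P :=
    Integrable.of_bound hg.aestronglyMeasurable M (Filter.Eventually.of_forall hM)
  have hη3 : 0 < η / 3 := by positivity
  -- With this `L¹` error, Markov's inequality gives `‖g - h‖ ≥ η / 3` with probability at most `ε /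
  -- 2`.
  obtain ⟨h, hh, -⟩ := hint.exists_boundedContinuous_lintegral_sub_le
    (ε := ENNReal.ofReal (η / 3 * (ε / 2))) (by simp; positivity)
  let S : Set (Euc n) := {x | ENNReal.ofReal (η / 3) ≤ ‖g x - h x‖ₑ}
  have hmeas : Measurable fun x => ‖g x - h x‖ₑ := (hg.sub h.continuous.measurable).enorm
  have hSm : MeasurableSet S := measurableSet_le measurable_const hmeas
  have hS : P S ≤ ENNReal.ofReal (ε / 2) := by
    have h1 := (mul_meas_ge_le_lintegral hmeas (ENNReal.ofReal (η / 3))).trans hh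
    rw [ENNReal.ofReal_mul hη3.le] at h1
    exact (ENNReal.mul_le_mul_iff_right (by simpa using hη) ENNReal.ofReal_ne_top).1 h1
  have hSr : P.real S ≤ ε / 2 := ENNReal.toReal_le_of_le_ofReal (by positivity) hS
  have hSc : P.real Sᶜ = 1 - P.real S := probReal_compl_eq_one_sub hSm
  -- Strictness keeps `X` non-empty even when `ε = 1`.
  have hlt : ENNReal.ofReal (1 - ε) < P Sᶜ := by
    rw [← ofReal_measureReal (measure_ne_top P Sᶜ)]
    exact ENNReal.ofReal_lt_ofReal_iff_of_nonneg (by linarith) |>.2 (by linarith)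
  obtain ⟨X, hXS, hXc, hX⟩ := hSm.compl.exists_lt_isCompact hlt
  refine ⟨X, hXc, nonempty_of_measure_ne_zero (hX.trans_le' zero_le).ne', ?_, ?_⟩
  · have := (ENNReal.ofReal_lt_iff_lt_toReal (by linarith) (measure_ne_top P X)).1 hX
    change 1 - (P X).toReal ≤ ε
    linarith
  · obtain ⟨δ, hδ, hunif⟩ := Metric.uniformContinuousOn_iff.1
      (hXc.uniformContinuousOn_of_continuous h.continuous.continuousOn) (η / 3) hη3
    refine ⟨δ, hδ, fun x hx x' hx' hd => ?_⟩
    have hclose : ∀ z ∈ X, dist (g z) (h z) ≤ η / 3 := by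
      intro z hz
      have hzS : ¬ ENNReal.ofReal (η / 3) ≤ ‖g z - h z‖ₑ := hXS hz
      rw [← ofReal_norm, ENNReal.ofReal_le_ofReal_iff (norm_nonneg _), not_le] at hzS
      rw [dist_eq_norm]
      exact hzS.le
    have h1 := hclose x hx
    have h2 := hclose x' hx'
    have h3 := hunif x hx x' hx' hd
    have h4 := dist_triangle4_right (g x) (g x') (h x) (h x')
    have h5 := dist_triangle (g x) (h x) (g x')
    have h6 := dist_triangle (h x) (h x') (g x')
    rw [dist_comm (h x') (g x')] at h6
    linarith

/-- Attention with scores which are affine in the query concentrates on the particles whose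
centre is close to the query. -/
lemma exists_network_sum_softmax_le {σ : ℝ → ℝ} (hσ : AdmissibleActivation σ) {n N : ℕ}
    (c : Fin N → Euc n) {X : Set (Euc n)} (hX : Bornology.IsBounded X) {δ κ : ℝ} (hδ : 0 < δ)
    (hκ : 0 < κ) (hnet : ∀ x ∈ X, ∃ j, dist x (c j) < δ) :
    ∃ f : Network n N, f.width ≤ 2 + n + N ∧ ∀ x ∈ X, ∀ k, 2 * δ ≤ dist x (c k) →
      softmax (f.eval σ x.ofLp) k ≤ κ := by
  obtain ⟨R, hR⟩ := hX.exists_norm_le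
  -- Squared distances to a far and a near centre differ by at least `(2δ)² - δ² = 3δ²`; the `2`
  -- absorbs an error of `1` in each of two scores.
  set lam : ℝ := (2 + |Real.log κ|) / (3 * δ ^ 2)
  have hlam : 0 ≤ lam := by positivity
  obtain ⟨f, hw, hf⟩ := exists_network_approx_affine hσ (fun k i => 2 * lam * c k i)
    (fun k => - lam * ‖c k‖ ^ 2) R one_pos
  refine ⟨f, hw, fun x hx k hk => ?_⟩
  obtain ⟨j, hj⟩ := hnet x hx
  have happ := hf x.ofLp fun i => (PiLp.norm_apply_le x i).trans (hR x hx)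
  have hscore : ∀ l, ∑ i, 2 * lam * c l i * x.ofLp i + -lam * ‖c l‖ ^ 2
      = lam * ‖x‖ ^ 2 - lam * dist x (c l) ^ 2 := by
    intro l
    rw [dist_eq_norm, norm_sub_sq_real, PiLp.inner_apply]
    simp only [RCLike.inner_apply, conj_trivial, mul_assoc, ← Finset.mul_sum]
    ring
  simp only [hscore] at happ
  have h1 := abs_le.1 (happ j)
  have h2 := abs_le.1 (happ k)
  have hk2 : (2 * δ) ^ 2 ≤ dist x (c k) ^ 2 := by gcongr
  have hj2 : dist x (c j) ^ 2 ≤ δ ^ 2 := by gcongr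
  have hprod : lam * (3 * δ ^ 2) ≤ lam * (dist x (c k) ^ 2 - dist x (c j) ^ 2) :=
    mul_le_mul_of_nonneg_left (by linarith) hlam
  have hl : lam * (3 * δ ^ 2) = 2 + |Real.log κ| := by
    simp only [lam]
    field_simp
  refine (softmax_le_exp_sub _ j k).trans ?_
  rw [← Real.le_log_iff_exp_le hκ]
  have := neg_abs_le (Real.log κ)
  rw [mul_sub] at hprod
  linarith [h1.1, h2.2]

/-- Every bounded measurable function is approximated, up to a set of small probability, by
attention over finitely many of its values, in the sense of expected distances. -/
lemma exists_network_sum_softmax_mul_dist_le {σ : ℝ → ℝ} (hσ : AdmissibleActivation σ) {n m : ℕ}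
    (P : Measure (Euc n)) [IsProbabilityMeasure P] {g : Euc n → Euc m} (hg : Measurable g)
    {M : ℝ} (hM : ∀ x, ‖g x‖ ≤ M) {ε : ℝ} (hε : 0 < ε) (hε1 : ε ≤ 1) :
    ∃ N : ℕ, 0 < N ∧ ∃ (f : Network n N) (c : Fin N → Euc n) (X : Set (Euc n)),
      f.width ≤ 2 + n + N ∧ IsCompact X ∧ 1 - P.real X ≤ ε ∧
      ∀ x ∈ X, ∑ k, softmax (f.eval σ x.ofLp) k * dist (g (c k)) (g x) ≤ ε := by
  obtain ⟨X, hXc, hXne, hXP, δ, hδ, hosc⟩ :=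
    exists_isCompact_dist_le P hg hM hε hε1 (half_pos hε)
  -- At radius `δ / 2`, the suppressed centres are those at distance at least `δ`; `hosc` handles
  -- the others.
  obtain ⟨t, htX, htf, hcov⟩ := hXc.finite_cover_balls (half_pos hδ)
  obtain ⟨N, c, hc⟩ : ∃ (N : ℕ) (c : Fin N → Euc n), Set.range c = t := by
    have := htf.to_subtype
    obtain ⟨N, ⟨e⟩⟩ := Finite.exists_equiv_fin t
    refine ⟨N, fun k => (e.symm k : Euc n), ?_⟩
    rw [show (fun k => (e.symm k : Euc n)) = Subtype.val ∘ e.symm from rfl, Set.range_comp,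
      e.symm.range_eq_univ, Set.image_univ, Subtype.range_coe]
  have hcX : ∀ k, c k ∈ X := fun k => htX (hc ▸ Set.mem_range_self k)
  have hnet : ∀ x ∈ X, ∃ j, dist x (c j) < δ / 2 := by
    intro x hx
    obtain ⟨y, hyt, hxy⟩ := Set.mem_iUnion₂.1 (hcov hx)
    obtain ⟨j, rfl⟩ : y ∈ Set.range c := hc ▸ hyt
    exact ⟨j, hxy⟩
  have hN : 0 < N := by
    obtain ⟨x, hx⟩ := hXne
    obtain ⟨j, -⟩ := hnet x hx
    exact j.pos
  have hM0 : 0 ≤ M := (norm_nonneg _).trans (hM 0)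
  have hN' : (0 : ℝ) < N := by exact_mod_cast hN
  -- At most `N` far particles, each within `2 * M + 1` of the target, then contribute at most `ε /
  -- 2`; the `+ 1` covers `M = 0`.
  set κ : ℝ := ε / (2 * N * (2 * M + 1))
  have hκ : 0 < κ := by positivity
  obtain ⟨f, hw, hf⟩ := exists_network_sum_softmax_le hσ c hXc.isBounded (half_pos hδ) hκ hnet
  refine ⟨N, hN, f, c, X, hw, hXc, hXP, fun x hx => ?_⟩
  have hterm : ∀ k, softmax (f.eval σ x.ofLp) k * dist (g (c k)) (g x) ≤
      softmax (f.eval σ x.ofLp) k * (ε / 2) + κ * (2 * M + 1) := by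
    intro k
    have hs := (softmax_pos (f.eval σ x.ofLp) k).le
    by_cases hk : dist x (c k) < δ
    · have := mul_le_mul_of_nonneg_left (hosc (c k) (hcX k) x hx (by rwa [dist_comm])) hs
      have : 0 ≤ κ * (2 * M + 1) := by positivity
      linarith
    · have h1 := hf x hx k (by linarith)
      have h2 : dist (g (c k)) (g x) ≤ 2 * M + 1 := by
        have := dist_le_norm_add_norm (g (c k)) (g x)
        linarith [hM (c k), hM x]
      have h3 := mul_le_mul h1 h2 dist_nonneg hκ.le
      have : 0 ≤ softmax (f.eval σ x.ofLp) k * (ε / 2) := by positivity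
      linarith
  refine (Finset.sum_le_sum fun k _ => hterm k).trans ?_
  rw [Finset.sum_add_distrib, ← Finset.sum_mul, sum_softmax hN]
  simp only [Finset.sum_const, Finset.card_univ, Fintype.card_fin, nsmul_eq_mul, κ]
  have : (N : ℝ) * (ε / (2 * N * (2 * M + 1)) * (2 * M + 1)) = ε / 2 := by field_simp
  linarith

lemma lintegral_edist_pAttention {N m : ℕ} (w : Fin N → ℝ) (Y : Fin N → Fin 1 → Euc m)
    (b : Euc m) : ∫⁻ z, edist z b ∂(pAttention w Y) =
      ENNReal.ofReal (∑ k, softmax w k * dist (Y k 0) b) := by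
  rw [lintegral_pAttention, ENNReal.ofReal_sum_of_nonneg
    fun k _ => mul_nonneg (softmax_pos w k).le dist_nonneg]
  simp [ENNReal.ofReal_mul (softmax_pos w _).le, edist_dist]

/-! ### The theorem. -/

theorem mainTheorem7 {n m : ℕ} (σ : ℝ → ℝ) (hσ : AdmissibleActivation σ)
    (K : Set (Euc m)) (hKne : K.Nonempty) (hK : IsCompact K)
    (C : Euc n → Set (Euc m)) (hC : WeaklyMeasurableCorrespondence K C)
    (hCclosed : ∀ x, IsClosed (C x)) (hCK : ∀ x, (C x ∩ K).Nonempty)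
    (L : Euc n → Euc m → ℝ) (hLcont : ∀ x, Continuous (L x))
    (hLmeas : ∀ y, Measurable (fun x => L x y))
    (P : Measure (Euc n)) [IsProbabilityMeasure P]
    (hconv : ∀ x, Convex ℝ (C x ∩ K)) (hL : ∀ x, StrictConvexOn ℝ Set.univ (L x)) :
    ∃ ystar : Euc n → Euc m,
      -- `ystar x` is the unique minimizer of `L x` on `C x ∩ K`
      (∀ x, argminOn (L x) (C x ∩ K) = {ystar x}) ∧
      ∀ ε : ℝ, 0 < ε → ε ≤ 1 →
        -- there is a model with an `N × m` matrix of particles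
        (∃ N : ℕ, 0 < N ∧ ∃ (f : Network n N) (Y : Fin N → Fin 1 → Euc m) (X : Set (Euc n)),
          ProbablyApproximatelyOptimal σ K C L P ε f Y X) ∧
        -- the mean of every such model, also with an `N × Q × m` array of particles
        ∀ (N Q : ℕ), 0 < N → 0 < Q →
          ∀ (f : Network n N) (Y : Fin N → Fin Q → Euc m) (X : Set (Euc n)),
          ProbablyApproximatelyOptimal σ K C L P ε f Y X →
          ∀ (Ω : Type*) [MeasurableSpace Ω] (μ : Measure Ω) [IsProbabilityMeasure μ]
            (Z : Euc n → Ω → Euc m), (∀ x, HasLaw (Z x) (model σ f Y x) μ) →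
            (∀ x, Integrable (Z x) μ ∧
              ∫ ω, Z x ω ∂μ = attention (f.eval σ x.ofLp) (averagedParticles Y)) ∧
            (Convex ℝ K → ∀ x, ∫ ω, Z x ω ∂μ ∈ K) ∧
            (∀ x ∈ X, ‖(∫ ω, Z x ω ∂μ) - ystar x‖ ≤ ε) := by
  choose ystar hy using fun x => exists_argminOn_eq_singleton (hLcont x) (hL x)
    (hK.inter_left (hCclosed x)) (hCK x) (hconv x)
  have hmem : ∀ x, ystar x ∈ K := fun x => by
    have : ystar x ∈ argminOn (L x) (C x ∩ K) := by rw [hy x]; rfl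
    exact this.1.2
  have hmeas : Measurable ystar :=
    measurable_of_argminOn_eq_singleton hK hC hCclosed hLcont hLmeas hy
  refine ⟨ystar, hy, fun ε hε hε1 => ⟨?_, ?_⟩⟩
  · obtain ⟨M, hM⟩ := hK.isBounded.exists_norm_le
    obtain ⟨N, hN, f, c, X, hw, hXc, hXP, hsum⟩ := exists_network_sum_softmax_mul_dist_le hσ P
      hmeas (fun x => hM _ (hmem x)) hε hε1
    refine ⟨N, hN, f, fun k _ => ystar (c k), X, hw, ?_, hXc, fun x hx => ?_, hXP⟩
    · exact Set.iUnion_subset fun x =>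
        support_pAttention_subset _ _ hK.isClosed fun k _ => hmem (c k)
    · have := isProbabilityMeasure_pAttention (f.eval σ x.ofLp)
        (fun k (_ : Fin 1) => ystar (c k)) hN one_pos
      rw [hy x, model, W1ToSet_singleton, lintegral_edist_pAttention]
      exact ENNReal.ofReal_le_ofReal (hsum x hx)
  · intro N Q hN hQ f Y X hopt Ω _ μ _ Z hZ
    -- Any query would serve in place of `0`, since all weights are positive at every query.
    have hYK : ∀ k q, Y k q ∈ K := fun k q => hopt.support_subset
      (Set.mem_iUnion_of_mem 0 (mem_support_pAttention _ Y k q))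
    have hint : ∀ x, Integrable (Z x) μ := fun x => by
      have h := integrable_pAttention (f.eval σ x.ofLp) Y hQ (id : Euc m → Euc m)
      rw [← model, ← (hZ x).map_eq] at h
      exact (integrable_map_measure aestronglyMeasurable_id (hZ x).aemeasurable).1 h
    have hmean : ∀ x, ∫ ω, Z x ω ∂μ =
        attention (f.eval σ x.ofLp) (averagedParticles Y) := fun x => by
      rw [(hZ x).integral_eq, model, integral_pAttention, attention_averagedParticles]
    refine ⟨fun x => ⟨hint x, hmean x⟩, fun hKc x => ?_, fun x hx => ?_⟩
    · rw [hmean x]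
      exact attention_averagedParticles_mem _ Y hN hQ hKc hYK
    · refine norm_integral_sub_le_of_lintegral_edist_le (hint x) _ hε.le ?_
      have hp := isProbabilityMeasure_pAttention (f.eval σ x.ofLp) Y hN hQ
      have h := hopt.optimal x hx
      rw [hy x, model, W1ToSet_singleton, ← model] at h
      rwa [← (hZ x).lintegral_comp (f := fun z => edist z (ystar x)) (by fun_prop)] at h
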